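/- Let $U,V_1,V_2,\dots$ be independent random variables, each uniformly distributed on $[0,1]$. For an integer $K\ge 1$, a function $F$ on $[0,1]^K$ is called IC-balanced (independence-comonotonicity balanced) if $F(V_1,\dots,V_K)$ and $F(U,\dots,U)$ have the same distribution. (i) Let $\phi:[0,1]\to[-\infty,\infty]$ be continuous and strictly monotone (increasing or decreasing), and for $K\ge1$ let $$M_{\phi,K}(p_1,\dots,p_K)=\phi^{-1}\Big(\frac1K\sum_{i=1}^K\phi(p_i)\Big),\qquad p_1,\dots,p_K\in[0,1],$$ where $\phi^{-1}$ is the inverse of $\phi$ on $\phi([0,1])$ (and a sum containing both $+\infty$ and $-\infty$ is read as $-\infty$). Then the following are equivalent: - (a) $M_{\phi,K}$ is IC-balanced for every integer $K\ge1$; - (b) there are real numbers $a\neq0$ and $b$ such that $\phi(p)=a\tan\!\big(\pi(p-\tfrac12)\big)+b$ for all $p\in(0,1)$; - (c) for every $K\ge 1$, $M_{\phi,K}$ is the Cauchy combining function on $(0,1)^K$, i.e. $M_{\phi,K}(p_1,\dots,p_K)=\mathcal C\big(\frac1K\sum_{i=1}^K\tan(\pi(p_i-\tfrac12))\big)$ for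 all $p_1,\dots,p_K\in(0,1)$, where $\mathcal C(x)=\frac1\pi\arctan x+\frac12$ is the standard Cauchy distribution function. (ii) Let $K\ge1$ and let $\alpha=(\alpha_1,\dots,\alpha_K)\in[0,\infty)^K$ be not identically zero. For $p\in[0,1]^K$ with order statistics $p_{(1)}\le\dots\le p_{(K)}$ let $$S_{\alpha,K}(p_1,\dots,p_K)=\min_{1\le i\le K}\frac{p_{(i)}}{\alpha_i},$$ with the convention $p_{(i)}/\alpha_i=\infty$ if $\alpha_i=0$, and let $S_K(p_1,\dots,p_K)=\min_{1\le i\le K}\frac{K p_{(i)}}{i}$ be the Simes function. Then $S_{\alpha,K}$ is IC-balanced if and only if there is a constant $c>0$ with $S_{\alpha,K}=c\,S_K$ on $[0,1]^K$. -/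

import Mathlib

open MeasureTheory ProbabilityTheory

noncomputable section

/-- A function `F` on `[0,1]^K` is independence-comonotonicity balanced if `F(V₁,…,V_K)` and
`F(U,…,U)` have the same law, where `U, V₁, …, V_K` are independent and uniform on `[0,1]`.
The joint law of `(V₁,…,V_K)` is the product measure `volume` on `Fin K → unitInterval`, and the
law of `U` is `volume` on `unitInterval`. (`IdentDistrib` includes a.e.-measurability of both
functions.) -/
def ICBalanced {β : Type*} [MeasurableSpace β] {K : ℕ} (F : (Fin K → unitInterval) → β) : Prop :=
  IdentDistrib F (fun u : unitInterval => F (fun _ => u))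
    (volume : Measure (Fin K → unitInterval)) (volume : Measure unitInterval)

/-- The generalized mean `M_{φ,K}(p) = φ⁻¹ ((φ(p₁) + ⋯ + φ(p_K)) / K)`. For `φ` continuous and
strictly monotone the argument of `φ⁻¹` lies in the range of `φ`, on which `Function.invFun φ` is
the inverse of `φ`. (A sum containing both `+∞` and `-∞` can only occur when one coordinate is `0`
and another is `1`; it is read as `-∞`.) -/
def generalizedMean (φ : unitInterval → EReal) (K : ℕ) (p : Fin K → unitInterval) :
    unitInterval :=
  Function.invFun φ ((∑ i, φ (p i)) / (K : EReal))

/-- The standard Cauchy distribution function. -/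
def stdCauchyCDF (x : ℝ) : ℝ := Real.arctan x / Real.pi + 1 / 2

/-- The standard Cauchy quantile function (meaningful for `p ∈ (0,1)`). -/
def stdCauchyQuantile (p : ℝ) : ℝ := Real.tan (Real.pi * (p - 1 / 2))

/-- The Cauchy combining function (meaningful for `p ∈ (0,1)^K`). -/
def cauchyCombination (K : ℕ) (p : Fin K → unitInterval) : ℝ :=
  stdCauchyCDF ((∑ i, stdCauchyQuantile (p i)) / K)

/-- The order statistic `p_(i+1)`: indices start at `0`, so `orderStat p 0` is the smallest
coordinate of `p`. -/
def orderStat {K : ℕ} (p : Fin K → unitInterval) (i : Fin K) : unitInterval :=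
  p (Tuple.sort p i)

/-- The order-statistics function `S_{α,K}(p) = min_i p_(i) / α_i`, where `p_(i) / α_i = ∞`
whenever `α_i = 0`. -/
def orderStatFun {K : ℕ} (α : Fin K → NNReal) (p : Fin K → unitInterval) : ENNReal :=
  ⨅ i, if α i = 0 then ⊤ else ENNReal.ofReal (orderStat p i : ℝ) / (α i : ENNReal)

/-- The Simes function `min_{1 ≤ i ≤ K} p_(i) / (i / K)`. -/
def simes (K : ℕ) (p : Fin K → unitInterval) : ENNReal :=
  orderStatFun (fun i : Fin K => ((i : NNReal) + 1) / (K : NNReal)) p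

end

/-! Part (i). The endpoints are null and `φ` is finite and injective on (0,1), so applying `φ` turns
IC-balance for every `K` into a statement about the law μ of `φ(U)`: the mean of `K` independent
copies again has law μ. Its characteristic function f satisfies f(nt) = f(t)^n. Continuity forces
f(t) = exp(ct) for t ≥ 0, and conjugation symmetry gives exp(-γ|t| + ibt) on the whole line
(`charFun_eq_of_strictlyStable`). So μ is the law of γQ + b with Q standard Cauchy, and a strictly
monotone function of a uniform variable is recovered from its law once its direction is known
(`exists_eq_affine_quantile`). Conversely, exp(-|t|/K)^K = exp(-|t|) makes the Cauchy law stable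
under means (`map_mean_stdCauchyQuantile`).

Part (ii). The event S_α < x says that p_(i) < xα_i for some i, and does not change when α is
replaced by its running maximum. For the Simes weights it has probability x
(`volume_exists_orderStat_lt_simes`), by a leave-one-out argument as in the Benjamini–Hochberg
theorem. Conversely, balance gives the normalized monotone weights these same probabilities, and
their behaviour as x → 0 determines the weights (`eq_of_volume_eq`): if two weight vectors first
differ at the 0-based index j, one difference of the two events has probability at least of order
x^(j+1), the other at most of order x^(j+2). -/

/-! ### The characteristic function of the standard Cauchy law -/

lemma integrable_exp_neg_abs : Integrable (fun x : ℝ => Complex.exp (-(2 * Real.pi * |x| : ℝ))) := by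
  have hπ := Real.pi_pos
  rw [← integrableOn_univ, ← Set.Iic_union_Ioi (a := (0 : ℝ))]
  refine IntegrableOn.union ?_ ?_
  · refine (integrableOn_exp_mul_complex_Iic (a := (2 * Real.pi : ℝ)) ?_ 0).congr_fun ?_
      measurableSet_Iic
    · rw [Complex.ofReal_re]; positivity
    · intro x hx
      simp only [abs_of_nonpos (Set.mem_Iic.1 hx)]
      push_cast; ring_nf
  · refine (integrableOn_exp_mul_complex_Ioi (a := (-(2 * Real.pi) : ℝ)) ?_ 0).congr_fun ?_
      measurableSet_Ioi
    · rw [Complex.ofReal_re]; linarith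
    · intro x hx
      simp only [abs_of_pos (Set.mem_Ioi.1 hx)]
      push_cast; ring_nf

open scoped FourierTransform in
lemma fourier_exp_neg_abs (w : ℝ) :
    𝓕 (fun x : ℝ => Complex.exp (-(2 * Real.pi * |x| : ℝ))) w
      = ((cauchyPDFReal 0 1 w : ℝ) : ℂ) := by
  have hπ := Real.pi_pos
  have hint : Integrable (fun x : ℝ => Complex.exp (↑(-2 * Real.pi * inner ℝ x w) * Complex.I) •
      Complex.exp (-(2 * Real.pi * |x| : ℝ))) := by
    refine integrable_exp_neg_abs.bdd_mul (c := 1) (by fun_prop) (ae_of_all _ fun x => ?_)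
    rw [Complex.norm_exp_ofReal_mul_I]
  rw [Real.fourier_eq', ← intervalIntegral.integral_Iic_add_Ioi (b := 0) hint.integrableOn
    hint.integrableOn]
  have e1 : ∫ x in Set.Iic (0 : ℝ), Complex.exp (↑(-2 * Real.pi * inner ℝ x w) * Complex.I) •
      Complex.exp (-(2 * Real.pi * |x| : ℝ)) =
      ∫ x in Set.Iic (0 : ℝ), Complex.exp ((2 * Real.pi * (1 - w * Complex.I)) * x) := by
    refine setIntegral_congr_fun measurableSet_Iic fun x hx => ?_
    simp only [abs_of_nonpos (Set.mem_Iic.1 hx), smul_eq_mul, ← Complex.exp_add]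
    congr 1
    simp; ring
  have e2 : ∫ x in Set.Ioi (0 : ℝ), Complex.exp (↑(-2 * Real.pi * inner ℝ x w) * Complex.I) •
      Complex.exp (-(2 * Real.pi * |x| : ℝ)) =
      ∫ x in Set.Ioi (0 : ℝ), Complex.exp ((-(2 * Real.pi) * (1 + w * Complex.I)) * x) := by
    refine setIntegral_congr_fun measurableSet_Ioi fun x hx => ?_
    simp only [abs_of_pos (Set.mem_Ioi.1 hx), smul_eq_mul, ← Complex.exp_add]
    congr 1
    simp; ring
  have h1 : (1 - w * Complex.I : ℂ) ≠ 0 := fun h => by simpa using congrArg Complex.re h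
  have h2 : (1 + w * Complex.I : ℂ) ≠ 0 := fun h => by simpa using congrArg Complex.re h
  have h3 : (w ^ 2 + 1 : ℂ) ≠ 0 := by
    have : (w ^ 2 + 1 : ℂ) = ((w ^ 2 + 1 : ℝ) : ℂ) := by push_cast; ring
    rw [this, Complex.ofReal_ne_zero]; positivity
  have h4 : (Real.pi : ℂ) ≠ 0 := by exact_mod_cast hπ.ne'
  rw [e1, e2, integral_exp_mul_complex_Iic (by simpa using hπ),
    integral_exp_mul_complex_Ioi (by simpa using hπ)]
  rw [cauchyPDFReal_def]
  simp only [Complex.ofReal_zero, mul_zero, Complex.exp_zero]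
  push_cast
  simp only [sub_zero, one_pow]
  field_simp
  linear_combination (2 * (w : ℂ) ^ 2) * Complex.I_sq

open scoped FourierTransform in
-- Fourier inversion avoids integrating the density against exp(itx): the density is the transform
-- of the elementary function exp(-2π|x|). The argument t/(2π) reconciles the two normalizations of
-- the transform.
lemma charFun_cauchyMeasure_zero_one (t : ℝ) :
    charFun (cauchyMeasure 0 1) t = Complex.exp (-(|t| : ℝ)) := by
  have hπ := Real.pi_pos
  have hF : 𝓕 (fun x : ℝ => Complex.exp (-(2 * Real.pi * |x| : ℝ)))
      = fun w => ((cauchyPDFReal 0 1 w : ℝ) : ℂ) := funext fourier_exp_neg_abs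
  have key := Continuous.fourierInv_fourier_eq
    (f := fun x : ℝ => Complex.exp (-(2 * Real.pi * |x| : ℝ))) (by fun_prop)
    integrable_exp_neg_abs (by rw [hF]; exact (integrable_cauchyPDFReal 0).ofReal)
  have key' := congrFun key (t / (2 * Real.pi))
  rw [hF, Real.fourierInv_eq'] at key'
  rw [charFun_apply_real, cauchyMeasure_of_scale_ne_zero _ one_ne_zero,
    integral_withDensity_eq_integral_toReal_smul (measurable_cauchyPDF 0 1)
      (ae_of_all _ fun x => ENNReal.ofReal_lt_top)]
  have : Complex.exp (-(|t| : ℝ)) = Complex.exp (-(2 * Real.pi * |t / (2 * Real.pi)| : ℝ)) := by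
    rw [abs_div, abs_of_pos (by positivity : 0 < 2 * Real.pi)]
    congr 3
    field_simp
  rw [this, ← key']
  refine integral_congr_ae (ae_of_all _ fun x => ?_)
  simp only [cauchyPDF_def]
  rw [ENNReal.toReal_ofReal (cauchyPDF_pos 0 one_ne_zero x).le, Complex.real_smul, smul_eq_mul,
    mul_comm]
  congr 2
  simp only [RCLike.inner_apply, conj_trivial]
  push_cast
  field_simp

/-! ### Cauchy quantiles of uniform variables and means of independent copies -/

lemma stdCauchyCDF_mem_Ioo (x : ℝ) : stdCauchyCDF x ∈ Set.Ioo (0 : ℝ) 1 := by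
  have hπ := Real.pi_pos
  unfold stdCauchyCDF
  have h1 : Real.arctan x / Real.pi < 1 / 2 := by
    rw [div_lt_iff₀ hπ]; linarith [Real.arctan_lt_pi_div_two x]
  have h2 : -(1 / 2) < Real.arctan x / Real.pi := by
    rw [lt_div_iff₀ hπ]; linarith [Real.neg_pi_div_two_lt_arctan x]
  constructor <;> linarith

lemma stdCauchyQuantile_stdCauchyCDF (x : ℝ) : stdCauchyQuantile (stdCauchyCDF x) = x := by
  have hπ := Real.pi_pos
  unfold stdCauchyQuantile stdCauchyCDF
  convert Real.tan_arctan x using 2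
  field_simp; ring

lemma pi_mul_sub_half_mem_Ioo {p : ℝ} (hp : p ∈ Set.Ioo (0 : ℝ) 1) :
    Real.pi * (p - 1 / 2) ∈ Set.Ioo (-(Real.pi / 2)) (Real.pi / 2) := by
  have hπ := Real.pi_pos
  constructor <;> nlinarith [hp.1, hp.2]

lemma strictMonoOn_stdCauchyQuantile : StrictMonoOn stdCauchyQuantile (Set.Ioo (0 : ℝ) 1) := by
  intro p hp q hq hpq
  exact Real.strictMonoOn_tan (pi_mul_sub_half_mem_Ioo hp) (pi_mul_sub_half_mem_Ioo hq)
    (by have := Real.pi_pos; gcongr)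

lemma measurable_stdCauchyQuantile : Measurable stdCauchyQuantile := by
  unfold stdCauchyQuantile
  simp only [Real.tan_eq_sin_div_cos]
  fun_prop

lemma measurable_stdCauchyQuantile_coe :
    Measurable (fun u : unitInterval => stdCauchyQuantile u) :=
  measurable_stdCauchyQuantile.comp measurable_subtype_coe

lemma measurable_mean {g : unitInterval → ℝ} (hg : Measurable g) (K : ℕ) :
    Measurable (fun v : Fin K → unitInterval => (∑ i, g (v i)) / (K : ℝ)) := by
  fun_prop

lemma measurable_stdCauchyCDF : Measurable stdCauchyCDF := by
  unfold stdCauchyCDF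
  fun_prop

lemma ae_unitInterval_mem_Ioo : ∀ᵐ u : unitInterval, 0 < u ∧ u < 1 := by
  have h0 : ∀ᵐ u : unitInterval, u ≠ 0 := by simp [ae_iff]
  have h1 : ∀ᵐ u : unitInterval, u ≠ 1 := by simp [ae_iff]
  filter_upwards [h0, h1] with u hu0 hu1
  exact ⟨unitInterval.pos_iff_ne_zero.2 hu0, unitInterval.lt_one_iff_ne_one.2 hu1⟩

lemma coe_mem_Ioo {u : unitInterval} (h : 0 < u ∧ u < 1) : (u : ℝ) ∈ Set.Ioo (0 : ℝ) 1 := h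

lemma cauchyMeasure_zero_one_Iic (x : ℝ) :
    cauchyMeasure 0 1 (Set.Iic x) = ENNReal.ofReal (stdCauchyCDF x) := by
  have hπ := Real.pi_pos
  rw [cauchyMeasure_of_scale_ne_zero _ one_ne_zero, withDensity_apply _ measurableSet_Iic]
  simp only [cauchyPDF_def]
  rw [← ofReal_integral_eq_lintegral_ofReal (integrable_cauchyPDFReal 0).integrableOn
    (ae_of_all _ fun y => (cauchyPDF_pos 0 one_ne_zero y).le)]
  simp only [cauchyPDFReal_def', inv_one, mul_one, sub_zero, NNReal.coe_one, div_one]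
  rw [integral_const_mul, integral_Iic_inv_one_add_sq]
  congr 1
  unfold stdCauchyCDF
  field_simp

lemma map_stdCauchyQuantile :
    (volume : Measure unitInterval).map (fun u : unitInterval => stdCauchyQuantile u) = cauchyMeasure 0 1 := by
  have hm := measurable_stdCauchyQuantile_coe
  have := Measure.isProbabilityMeasure_map (μ := (volume : Measure unitInterval)) hm.aemeasurable
  refine Measure.ext_of_Iic _ _ fun x => ?_
  have hx := stdCauchyCDF_mem_Ioo x
  rw [Measure.map_apply hm measurableSet_Iic, cauchyMeasure_zero_one_Iic]
  have := unitInterval.volume_Iic ⟨stdCauchyCDF x, hx.1.le, hx.2.le⟩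
  rw [← this]
  refine measure_congr ?_
  filter_upwards [ae_unitInterval_mem_Ioo] with u hu
  refine propext ?_
  change stdCauchyQuantile u ≤ x ↔ (u : ℝ) ≤ stdCauchyCDF x
  rw [← strictMonoOn_stdCauchyQuantile.le_iff_le (coe_mem_Ioo hu) hx,
    stdCauchyQuantile_stdCauchyCDF]

lemma charFun_map_stdCauchyQuantile (t : ℝ) :
    charFun ((volume : Measure unitInterval).map (fun u : unitInterval => stdCauchyQuantile u)) t
      = Complex.exp (-(|t| : ℝ)) := by
  rw [map_stdCauchyQuantile, charFun_cauchyMeasure_zero_one]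

lemma charFun_map_mean {g : unitInterval → ℝ} (hg : Measurable g) (K : ℕ) (t : ℝ) :
    charFun ((volume : Measure (Fin K → unitInterval)).map (fun v => (∑ i, g (v i)) / K)) t
      = charFun ((volume : Measure unitInterval).map g) (t / K) ^ K := by
  rw [charFun_apply_real, charFun_apply_real,
    integral_map (measurable_mean hg K).aemeasurable (by fun_prop),
    integral_map hg.aemeasurable (by fun_prop)]
  have := integral_fintype_prod_volume_eq_pow (𝕜 := ℂ) (ι := Fin K) (E := unitInterval)
    (fun u => Complex.exp (((t / K : ℝ) : ℂ) * (g u : ℝ) * Complex.I))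
  rw [Fintype.card_fin] at this
  rw [← this]
  refine integral_congr_ae (ae_of_all _ fun v => ?_)
  simp only
  rw [← Complex.exp_sum]
  congr 1
  push_cast
  rw [← Finset.sum_mul, ← Finset.mul_sum]
  ring

/-! ### Strictly 1-stable laws -/

/-- All powers up to `n` stay in the right half-plane, so each multiplication by `w` adds two
arguments smaller than π/2 in modulus and never crosses the branch cut. -/
lemma Complex.log_pow_of_re_pos {w : ℂ} {n : ℕ} (h : ∀ j ≤ n, 0 < (w ^ j).re) :
    Complex.log (w ^ n) = n * Complex.log w := by
  induction n with
  | zero => simp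
  | succ n ih =>
    rcases Nat.eq_zero_or_pos n with rfl | hn
    · simp
    have h1 := h n (by omega)
    have h2 := h 1 (by omega)
    rw [pow_one] at h2
    have ne1 : w ^ n ≠ 0 := fun e => by rw [e] at h1; simp at h1
    have ne2 : w ≠ 0 := fun e => by rw [e] at h2; simp at h2
    have a1 := abs_lt.1 (Complex.abs_arg_lt_pi_div_two_iff.2 (Or.inl h1))
    have a2 := abs_lt.1 (Complex.abs_arg_lt_pi_div_two_iff.2 (Or.inl h2))
    rw [pow_succ, Complex.log_mul ne1 ne2 ⟨by linarith, by linarith⟩,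
      ih fun j hj => h j (by omega)]
    push_cast; ring

/-- A continuous function with `f (n t) = f t ^ n` is exponential on `[0, ∞)`. -/
lemma exists_exp_of_map_nat_mul_eq_pow {f : ℝ → ℂ} (hf : Continuous f) (h0 : f 0 = 1)
    (hpow : ∀ (n : ℕ) (t : ℝ), f (n * t) = f t ^ n) :
    ∃ c : ℂ, ∀ t : ℝ, 0 ≤ t → f t = Complex.exp (c * t) := by
  -- Near 0 the values lie in the right half-plane, so logarithms on [0, δ] are consistent and roots
  -- of `f δ` are unambiguous.
  obtain ⟨δ, hδ, hre⟩ : ∃ δ > 0, ∀ t, |t| ≤ δ → 0 < (f t).re := by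
    have : ∀ᶠ t in nhds (0 : ℝ), 0 < (f t).re :=
      (Complex.continuous_re.comp hf).continuousAt.eventually_const_lt (by simp [h0])
    obtain ⟨ε, hε, h⟩ := Metric.eventually_nhds_iff.1 this
    exact ⟨ε / 2, by positivity, fun t ht => h (by rw [Real.dist_0_eq_abs]; linarith)⟩
  have key : ∀ m n : ℕ, 0 < n →
      f (δ * (m / n)) = Complex.exp (Complex.log (f δ) * ((m / n : ℝ) : ℂ)) := by
    intro m n hn
    have hn' : (n : ℝ) ≠ 0 := by positivity
    have hnC : (n : ℂ) ≠ 0 := by exact_mod_cast hn.ne'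
    have hw : f δ = f (δ / n) ^ n := by rw [← hpow]; congr 1; field_simp
    have hlog : Complex.log (f δ) = n * Complex.log (f (δ / n)) := by
      rw [hw]
      refine Complex.log_pow_of_re_pos fun j hj => ?_
      rw [← hpow]
      refine hre _ ?_
      rw [abs_of_nonneg (by positivity), ← mul_div_assoc, div_le_iff₀ (by positivity), mul_comm]
      have : (j : ℝ) ≤ n := by exact_mod_cast hj
      gcongr
    have hne : f (δ / n) ≠ 0 := by
      intro e
      have := hre δ (by rw [abs_of_pos hδ])
      rw [hw, e, zero_pow hn.ne'] at this
      simp at this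
    have : δ * (m / n) = m * (δ / n) := by ring
    rw [this, hpow, hlog]
    push_cast
    have : (n : ℂ) * Complex.log (f (δ / n)) * (m / n) = m * Complex.log (f (δ / n)) := by
      field_simp
    rw [this, Complex.exp_nat_mul, Complex.exp_log hne]
  refine ⟨Complex.log (f δ) / δ, fun t ht => ?_⟩
  -- The identity is known at nonnegative rationals; the absolute value makes both sides continuous
  -- functions on ℝ agreeing on all of ℚ.
  have hext : (fun r : ℝ => f (δ * |r|)) =
      fun r : ℝ => Complex.exp (Complex.log (f δ) * ((|r| : ℝ) : ℂ)) := by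
    refine DenseRange.equalizer (Rat.denseRange_cast (𝕜 := ℝ)) (by fun_prop) (by fun_prop) ?_
    funext r
    have hr : |(r : ℝ)| = (r.num.natAbs : ℝ) / r.den := by
      rw [Rat.cast_def, abs_div, Nat.abs_cast, Nat.cast_natAbs, Int.cast_abs]
    simp only [Function.comp_apply, hr]
    exact key _ _ r.den_pos
  have := congrFun hext (t / δ)
  simp only [abs_of_nonneg (div_nonneg ht hδ.le)] at this
  rw [mul_div_cancel₀ _ hδ.ne'] at this
  rw [this]
  congr 1
  push_cast; ring

/-- The characteristic function of a strictly `1`-stable law. -/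
lemma charFun_eq_of_strictlyStable (μ : Measure ℝ) [IsProbabilityMeasure μ]
    (h : ∀ K : ℕ, 1 ≤ K → ∀ t, charFun μ (t / K) ^ K = charFun μ t) :
    ∃ γ b : ℝ, 0 ≤ γ ∧ ∀ t, charFun μ t = Complex.exp (-(γ * |t| : ℝ) + (b * t : ℝ) * Complex.I) := by
  have h0 : charFun μ 0 = 1 := by simp
  obtain ⟨c, hc⟩ := exists_exp_of_map_nat_mul_eq_pow (f := charFun μ) continuous_charFun h0 (by
    intro n t
    rcases Nat.eq_zero_or_pos n with rfl | hn
    · simp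
    · rw [← h n hn, mul_div_cancel_left₀]
      positivity)
  refine ⟨-c.re, c.im, ?_, fun t => ?_⟩
  · have h1 := norm_charFun_le_one (μ := μ) (t := (1 : ℝ))
    rw [hc 1 zero_le_one, Complex.norm_exp] at h1
    simp at h1
    linarith
  · have pos : ∀ t : ℝ, 0 ≤ t →
        charFun μ t = Complex.exp (-(-c.re * |t| : ℝ) + (c.im * t : ℝ) * Complex.I) := by
      intro t ht
      rw [hc t ht, abs_of_nonneg ht]
      congr 1
      apply Complex.ext <;> simp
    rcases le_total 0 t with ht | ht
    · exact pos t ht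
    · have := pos (-t) (by linarith)
      rw [charFun_neg] at this
      rw [← Complex.conj_conj (charFun μ t), this, ← Complex.exp_conj]
      congr 1
      apply Complex.ext <;> simp

lemma map_mean_stdCauchyQuantile {K : ℕ} (hK : 1 ≤ K) :
    (volume : Measure (Fin K → unitInterval)).map (fun v => (∑ i, stdCauchyQuantile (v i)) / K)
      = (volume : Measure unitInterval).map (fun u : unitInterval => stdCauchyQuantile u) := by
  have hm := measurable_stdCauchyQuantile_coe
  have := Measure.isProbabilityMeasure_map (μ := (volume : Measure unitInterval)) hm.aemeasurable
  have := Measure.isProbabilityMeasure_map (μ := (volume : Measure (Fin K → unitInterval)))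
    (measurable_mean hm K).aemeasurable
  refine Measure.ext_of_charFun (funext fun t => ?_)
  rw [charFun_map_mean (g := fun u => stdCauchyQuantile u) hm, charFun_map_stdCauchyQuantile,
    charFun_map_stdCauchyQuantile, ← Complex.exp_nat_mul]
  congr 1
  have : (K : ℂ) ≠ 0 := by exact_mod_cast (by omega : K ≠ 0)
  rw [abs_div, Nat.abs_cast]
  push_cast
  field_simp

/-! ### Generalized means -/

/-- Strictness confines infinite values to the endpoints. -/
lemma coe_toReal_of_strict {φ : unitInterval → EReal} (h : StrictMono φ ∨ StrictAnti φ)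
    {p : unitInterval} (hp : 0 < p ∧ p < 1) : (((φ p).toReal : ℝ) : EReal) = φ p := by
  rcases h with h | h
  · exact EReal.coe_toReal ((h hp.2).trans_le le_top).ne (bot_le.trans_lt (h hp.1)).ne'
  · exact EReal.coe_toReal ((h hp.1).trans_le le_top).ne (bot_le.trans_lt (h hp.2)).ne'

lemma injective_of_strict {φ : unitInterval → EReal} (h : StrictMono φ ∨ StrictAnti φ) :
    Function.Injective φ := h.elim StrictMono.injective StrictAnti.injective

lemma EReal.coe_sum_div_natCast {ι : Type*} (s : Finset ι) (f : ι → ℝ) (K : ℕ) :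
    (∑ i ∈ s, (f i : EReal)) / (K : EReal) = (((∑ i ∈ s, f i) / K : ℝ) : EReal) := by
  have : ∑ i ∈ s, (f i : EReal) = ((∑ i ∈ s, f i : ℝ) : EReal) := by
    induction s using Finset.cons_induction with
    | empty => simp
    | cons a s ha ih => rw [Finset.sum_cons, Finset.sum_cons, ih, EReal.coe_add]
  rw [this, EReal.coe_div]
  rfl

/-- Some `φ (p i)` is at most the average and some is at least it, so by the intermediate value
theorem the average lies in the range of `φ`, where `Function.invFun` is a genuine inverse. -/
lemma apply_generalizedMean {φ : unitInterval → EReal} (hc : Continuous φ)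
    (h : StrictMono φ ∨ StrictAnti φ) {K : ℕ} (hK : 1 ≤ K) {p : Fin K → unitInterval}
    (hp : ∀ i, 0 < p i ∧ p i < 1) :
    φ (generalizedMean φ K p) = (((∑ i, (φ (p i)).toReal) / K : ℝ) : EReal) := by
  have hsum : (∑ i, φ (p i)) / (K : EReal) = (((∑ i, (φ (p i)).toReal) / K : ℝ) : EReal) := by
    rw [← EReal.coe_sum_div_natCast]
    simp only [fun i => coe_toReal_of_strict h (hp i)]
  rw [← hsum]
  refine Function.invFun_eq ?_
  rw [hsum]
  have hne : (Finset.univ : Finset (Fin K)).Nonempty := ⟨⟨0, hK⟩, Finset.mem_univ _⟩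
  have hK' : (0 : ℝ) < K := by exact_mod_cast hK
  refine mem_range_of_exists_le_of_exists_ge hc ?_ ?_
  · obtain ⟨i, -, hi⟩ := Finset.exists_le_of_sum_le (s := Finset.univ)
      (f := fun i => (φ (p i)).toReal) (g := fun _ => (∑ i, (φ (p i)).toReal) / (K : ℝ)) hne
      (by simp; rw [mul_div_cancel₀ _ hK'.ne'])
    exact ⟨p i, by rw [← coe_toReal_of_strict h (hp i)]; exact_mod_cast hi⟩
  · obtain ⟨i, -, hi⟩ := Finset.exists_le_of_sum_le (s := Finset.univ)
      (g := fun i => (φ (p i)).toReal) (f := fun _ => (∑ i, (φ (p i)).toReal) / (K : ℝ)) hne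
      (by simp; rw [mul_div_cancel₀ _ hK'.ne'])
    exact ⟨p i, by rw [← coe_toReal_of_strict h (hp i)]; exact_mod_cast hi⟩

lemma generalizedMean_diag {φ : unitInterval → EReal} (hc : Continuous φ)
    (h : StrictMono φ ∨ StrictAnti φ) {K : ℕ} (hK : 1 ≤ K) {u : unitInterval}
    (hu : 0 < u ∧ u < 1) : generalizedMean φ K (fun _ => u) = u := by
  have hK' : (0 : ℝ) < K := by exact_mod_cast hK
  apply injective_of_strict h
  rw [apply_generalizedMean hc h hK fun _ => hu, ← coe_toReal_of_strict h hu]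
  congr 1
  simp only [Finset.sum_const, Finset.card_univ, Fintype.card_fin, nsmul_eq_mul]
  rw [coe_toReal_of_strict h hu, mul_div_cancel_left₀ _ hK'.ne']

lemma ae_forall_mem_Ioo (K : ℕ) : ∀ᵐ v : Fin K → unitInterval, ∀ i, 0 < v i ∧ v i < 1 := by
  rw [ae_all_iff]
  intro i
  exact (Measure.quasiMeasurePreserving_eval
    (fun _ : Fin K => (volume : Measure unitInterval)) i).ae ae_unitInterval_mem_Ioo

/-- If `generalizedMean φ K` is balanced, the mean of `K` independent copies of `φ(U)` is
distributed like `φ(U)`. -/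
lemma map_mean_eq_of_icBalanced {φ : unitInterval → EReal} (hc : Continuous φ)
    (h : StrictMono φ ∨ StrictAnti φ) {K : ℕ} (hK : 1 ≤ K)
    (hb : ICBalanced (generalizedMean φ K)) :
    (volume : Measure (Fin K → unitInterval)).map (fun v => (∑ i, (φ (v i)).toReal) / (K : ℝ))
      = (volume : Measure unitInterval).map (fun u => (φ u).toReal) := by
  have hg : Measurable (fun u => (φ u).toReal) := hc.measurable.ereal_toReal
  have := (hb.comp hg).map_eq
  convert this using 1
  · refine Measure.map_congr ?_
    filter_upwards [ae_forall_mem_Ioo K] with v hv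
    simp only [Function.comp_apply]
    rw [apply_generalizedMean hc h hK hv, EReal.toReal_coe]
  · refine Measure.map_congr ?_
    filter_upwards [ae_unitInterval_mem_Ioo] with u hu
    simp only [Function.comp_apply]
    rw [generalizedMean_diag hc h hK hu]

lemma map_eq_affine_quantile {φ : unitInterval → EReal} (hc : Continuous φ)
    (h : StrictMono φ ∨ StrictAnti φ) (hb : ∀ K : ℕ, 1 ≤ K → ICBalanced (generalizedMean φ K)) :
    ∃ γ b : ℝ, 0 < γ ∧ (volume : Measure unitInterval).map (fun u => (φ u).toReal)
      = (volume : Measure unitInterval).map (fun u : unitInterval => γ * stdCauchyQuantile u + b) := by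
  have hg : Measurable (fun u => (φ u).toReal) := hc.measurable.ereal_toReal
  have hq := measurable_stdCauchyQuantile_coe
  have := Measure.isProbabilityMeasure_map (μ := (volume : Measure unitInterval)) hg.aemeasurable
  obtain ⟨γ, b, hγ, hf⟩ := charFun_eq_of_strictlyStable
    ((volume : Measure unitInterval).map (fun u => (φ u).toReal)) (by
      intro K hK t
      rw [← charFun_map_mean hg, map_mean_eq_of_icBalanced hc h hK (hb K hK)])
  have hm : Measurable (fun u : unitInterval => γ * stdCauchyQuantile u + b) := by fun_prop
  have := Measure.isProbabilityMeasure_map (μ := (volume : Measure unitInterval)) hm.aemeasurable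
  have hmap : (volume : Measure unitInterval).map (fun u => (φ u).toReal)
      = (volume : Measure unitInterval).map (fun u : unitInterval => γ * stdCauchyQuantile u + b) := by
    refine Measure.ext_of_charFun (funext fun t => ?_)
    have hcomp : (volume : Measure unitInterval).map (fun u : unitInterval => γ * stdCauchyQuantile u + b)
        = (((volume : Measure unitInterval).map (fun u : unitInterval =>
          stdCauchyQuantile u)).map (fun x => γ * x)).map (fun x => x + b) := by
      rw [Measure.map_map (by fun_prop) (by fun_prop), Measure.map_map (by fun_prop) hq]
      rfl
    rw [hcomp, charFun_map_add_const, charFun_map_mul, charFun_map_stdCauchyQuantile, hf,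
      ← Complex.exp_add]
    congr 1
    rw [abs_mul, abs_of_nonneg hγ]
    simp [mul_comm]
  refine ⟨γ, b, lt_of_le_of_ne hγ ?_, hmap⟩
  -- Scale zero would make the law a point mass at `b`, whereas injectivity of `φ` on (0,1) leaves
  -- at most one interior point with value `b`.
  rintro rfl
  have h1 : (volume : Measure unitInterval).map (fun u => (φ u).toReal) {b} = 1 := by
    rw [hmap]
    simp
  rw [Measure.map_apply hg (measurableSet_singleton b)] at h1
  have h2 : volume {u : unitInterval | (0 < u ∧ u < 1) ∧ (φ u).toReal = b} = 0 := by
    refine Set.Subsingleton.measure_zero ?_ _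
    rintro u ⟨hu, hu'⟩ v ⟨hv, hv'⟩
    apply injective_of_strict h
    rw [← coe_toReal_of_strict h hu, ← coe_toReal_of_strict h hv, hu', hv']
  have h3 : volume ((fun u => (φ u).toReal) ⁻¹' {b}) = 0 := by
    rw [← h2]
    refine measure_congr ?_
    filter_upwards [ae_unitInterval_mem_Ioo] with u hu
    refine propext ?_
    change (φ u).toReal = b ↔ (0 < u ∧ u < 1) ∧ (φ u).toReal = b
    simp [hu]
  rw [h3] at h1
  exact zero_ne_one h1

lemma volume_affine_quantile_le {γ b y : ℝ} (hγ : 0 < γ) :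
    (volume : Measure unitInterval) {u | γ * stdCauchyQuantile u + b ≤ y}
      = ENNReal.ofReal (stdCauchyCDF ((y - b) / γ)) := by
  have := cauchyMeasure_zero_one_Iic ((y - b) / γ)
  rw [← map_stdCauchyQuantile,
    Measure.map_apply measurable_stdCauchyQuantile_coe measurableSet_Iic] at this
  rw [← this]
  congr 1
  ext u
  simp only [Set.mem_ofPred_eq, Set.mem_preimage, Set.mem_Iic]
  rw [le_div_iff₀ hγ]
  constructor <;> intro h <;> linarith

/-- The distribution function of `φ(U)` at `φ p` is `p` when `φ` increases and `1 - p` when it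
decreases. Equating it with the Cauchy one and inverting gives `φ p`; in the decreasing case the
quantile is odd about 1/2, whence `a = -γ`. -/
lemma exists_eq_affine_quantile {φ : unitInterval → EReal} (h : StrictMono φ ∨ StrictAnti φ)
    (hc : Continuous φ) {γ b : ℝ} (hγ : 0 < γ)
    (hmap : (volume : Measure unitInterval).map (fun u => (φ u).toReal)
      = (volume : Measure unitInterval).map (fun u : unitInterval => γ * stdCauchyQuantile u + b)) :
    ∃ a b : ℝ, a ≠ 0 ∧ ∀ p : unitInterval, 0 < p → p < 1 →
      φ p = ((a * stdCauchyQuantile p + b : ℝ) : EReal) := by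
  have hg : Measurable (fun u => (φ u).toReal) := hc.measurable.ereal_toReal
  have hm : Measurable (fun u : unitInterval => γ * stdCauchyQuantile u + b) :=
    (measurable_stdCauchyQuantile_coe.const_mul γ).add_const b
  have hlaw : ∀ y, (volume : Measure unitInterval) {u | (φ u).toReal ≤ y}
      = ENNReal.ofReal (stdCauchyCDF ((y - b) / γ)) := by
    intro y
    have := congrArg (fun m => m (Set.Iic y)) hmap
    rw [Measure.map_apply hg measurableSet_Iic, Measure.map_apply hm measurableSet_Iic] at this
    rw [← volume_affine_quantile_le hγ]
    exact this
  have hle : ∀ {u v : unitInterval}, (0 < u ∧ u < 1) → (0 < v ∧ v < 1) →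
      ((φ u).toReal ≤ (φ v).toReal ↔ φ u ≤ φ v) := by
    intro u v hu hv
    rw [← EReal.coe_le_coe_iff, coe_toReal_of_strict h hu, coe_toReal_of_strict h hv]
  rcases h with hmono | hanti
  · refine ⟨γ, b, hγ.ne', fun p hp0 hp1 => ?_⟩
    rw [← coe_toReal_of_strict (Or.inl hmono) ⟨hp0, hp1⟩]
    congr 1
    have h1 := hlaw (φ p).toReal
    have h2 : (volume : Measure unitInterval) {u | (φ u).toReal ≤ (φ p).toReal}
        = ENNReal.ofReal p := by
      rw [← unitInterval.volume_Iic]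
      refine measure_congr ?_
      filter_upwards [ae_unitInterval_mem_Ioo] with u hu
      exact propext ((hle hu ⟨hp0, hp1⟩).trans hmono.le_iff_le)
    rw [h2, ENNReal.ofReal_eq_ofReal_iff p.2.1 (stdCauchyCDF_mem_Ioo _).1.le] at h1
    rw [h1, stdCauchyQuantile_stdCauchyCDF]
    field_simp
    ring
  · refine ⟨-γ, b, (neg_neg_of_pos hγ).ne, fun p hp0 hp1 => ?_⟩
    rw [← coe_toReal_of_strict (Or.inr hanti) ⟨hp0, hp1⟩]
    congr 1
    have h1 := hlaw (φ p).toReal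
    have h2 : (volume : Measure unitInterval) {u | (φ u).toReal ≤ (φ p).toReal}
        = ENNReal.ofReal (1 - p) := by
      rw [← unitInterval.volume_Ici]
      refine measure_congr ?_
      filter_upwards [ae_unitInterval_mem_Ioo] with u hu
      exact propext ((hle hu ⟨hp0, hp1⟩).trans hanti.le_iff_ge)
    rw [h2, ENNReal.ofReal_eq_ofReal_iff (by linarith [p.2.2]) (stdCauchyCDF_mem_Ioo _).1.le] at h1
    have h3 : stdCauchyQuantile (1 - p) = -stdCauchyQuantile p := by
      unfold stdCauchyQuantile
      rw [← Real.tan_neg]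
      congr 1; ring
    have h4 : stdCauchyQuantile p = -(((φ p).toReal - b) / γ) := by
      rw [← stdCauchyQuantile_stdCauchyCDF (((φ p).toReal - b) / γ), ← h1, h3, neg_neg]
    rw [h4]
    field_simp
    ring

/-- Averaging commutes with affine maps, so `a` and `b` drop out. -/
lemma generalizedMean_eq_cauchyCombination {φ : unitInterval → EReal} (hc : Continuous φ)
    (h : StrictMono φ ∨ StrictAnti φ) {a b : ℝ}
    (hφ : ∀ p : unitInterval, 0 < p → p < 1 →
      φ p = ((a * stdCauchyQuantile p + b : ℝ) : EReal))
    {K : ℕ} (hK : 1 ≤ K) {p : Fin K → unitInterval} (hp : ∀ i, 0 < p i ∧ p i < 1) :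
    (generalizedMean φ K p : ℝ) = cauchyCombination K p := by
  have hC := stdCauchyCDF_mem_Ioo ((∑ i, stdCauchyQuantile (p i)) / K)
  have hK' : (0 : ℝ) < K := by exact_mod_cast hK
  have : generalizedMean φ K p =
      ⟨stdCauchyCDF ((∑ i, stdCauchyQuantile (p i)) / K), hC.1.le, hC.2.le⟩ := by
    apply injective_of_strict h
    rw [apply_generalizedMean hc h hK hp, hφ _ hC.1 hC.2]
    congr 1
    simp only [stdCauchyQuantile_stdCauchyCDF, fun i => hφ (p i) (hp i).1 (hp i).2,
      EReal.toReal_coe]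
    rw [Finset.sum_add_distrib, ← Finset.mul_sum]
    simp
    field_simp
  rw [this]
  rfl

lemma icBalanced_of_eq_cauchyCombination {K : ℕ} (hK : 1 ≤ K)
    {F : (Fin K → unitInterval) → unitInterval}
    (hF : ∀ p : Fin K → unitInterval, (∀ i, 0 < p i ∧ p i < 1) →
      (F p : ℝ) = cauchyCombination K p) : ICBalanced F := by
  let C : ℝ → unitInterval := fun x =>
    ⟨stdCauchyCDF x, (stdCauchyCDF_mem_Ioo x).1.le, (stdCauchyCDF_mem_Ioo x).2.le⟩
  have hC : Measurable C := measurable_stdCauchyCDF.subtype_mk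
  have hK' : (0 : ℝ) < K := by exact_mod_cast hK
  have hq := measurable_stdCauchyQuantile_coe
  have hident : IdentDistrib
      (fun v : Fin K → unitInterval => (∑ i, stdCauchyQuantile (v i)) / (K : ℝ))
      (fun u : unitInterval => stdCauchyQuantile u) volume volume :=
    ⟨(measurable_mean hq K).aemeasurable, hq.aemeasurable, map_mean_stdCauchyQuantile hK⟩
  have h1 : C ∘ (fun v : Fin K → unitInterval => (∑ i, stdCauchyQuantile (v i)) / (K : ℝ))
      =ᵐ[volume] F := by
    filter_upwards [ae_forall_mem_Ioo K] with v hv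
    exact Subtype.ext (hF v hv).symm
  have h2 : C ∘ (fun u : unitInterval => stdCauchyQuantile u)
      =ᵐ[volume] fun u => F (fun _ => u) := by
    filter_upwards [ae_unitInterval_mem_Ioo] with u hu
    refine Subtype.ext ?_
    rw [hF _ fun _ => hu]
    simp only [cauchyCombination, Finset.sum_const, Finset.card_univ, Fintype.card_fin,
      nsmul_eq_mul]
    rw [mul_div_cancel_left₀ _ hK'.ne']
    rfl
  have h3 := hident.comp hC
  exact ((IdentDistrib.of_ae_eq h3.aemeasurable_fst h1).symm.trans h3).trans
    (IdentDistrib.of_ae_eq h3.aemeasurable_snd h2)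

theorem generalizedMean_icBalanced_iff {φ : unitInterval → EReal} (hc : Continuous φ)
    (h : StrictMono φ ∨ StrictAnti φ) :
    ((∀ K : ℕ, 1 ≤ K → ICBalanced (generalizedMean φ K)) ↔
      ∃ a b : ℝ, a ≠ 0 ∧ ∀ p : unitInterval, 0 < p → p < 1 →
        φ p = ((a * Real.tan (Real.pi * ((p : ℝ) - 1 / 2)) + b : ℝ) : EReal)) ∧
    ((∀ K : ℕ, 1 ≤ K → ICBalanced (generalizedMean φ K)) ↔
      ∀ K : ℕ, 1 ≤ K → ∀ p : Fin K → unitInterval, (∀ i, 0 < p i ∧ p i < 1) →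
        (generalizedMean φ K p : ℝ) = cauchyCombination K p) := by
  have hab : (∀ K : ℕ, 1 ≤ K → ICBalanced (generalizedMean φ K)) →
      ∃ a b : ℝ, a ≠ 0 ∧ ∀ p : unitInterval, 0 < p → p < 1 →
        φ p = ((a * Real.tan (Real.pi * ((p : ℝ) - 1 / 2)) + b : ℝ) : EReal) := by
    intro hb
    obtain ⟨γ, b, hγ, hmap⟩ := map_eq_affine_quantile hc h hb
    exact exists_eq_affine_quantile h hc hγ hmap
  have hbc : (∃ a b : ℝ, a ≠ 0 ∧ ∀ p : unitInterval, 0 < p → p < 1 →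
        φ p = ((a * Real.tan (Real.pi * ((p : ℝ) - 1 / 2)) + b : ℝ) : EReal)) →
      ∀ K : ℕ, 1 ≤ K → ∀ p : Fin K → unitInterval, (∀ i, 0 < p i ∧ p i < 1) →
        (generalizedMean φ K p : ℝ) = cauchyCombination K p := by
    rintro ⟨a, b, -, hφ⟩ K hK p hp
    exact generalizedMean_eq_cauchyCombination hc h hφ hK hp
  have hca : (∀ K : ℕ, 1 ≤ K → ∀ p : Fin K → unitInterval, (∀ i, 0 < p i ∧ p i < 1) →
        (generalizedMean φ K p : ℝ) = cauchyCombination K p) →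
      ∀ K : ℕ, 1 ≤ K → ICBalanced (generalizedMean φ K) :=
    fun hF K hK => icBalanced_of_eq_cauchyCombination hK (hF K hK)
  exact ⟨⟨hab, hca ∘ hbc⟩, ⟨hbc ∘ hab, hca⟩⟩

/-! ### Order statistics through counting -/

/-- The number of coordinates of `v` below `t`. -/
noncomputable def ltCount {K : ℕ} (v : Fin K → unitInterval) (t : ℝ) : ℕ :=
  (Finset.univ.filter fun k => (v k : ℝ) < t).card

lemma ltCount_mono {K : ℕ} (v : Fin K → unitInterval) : Monotone (ltCount v) := by
  intro s t hst
  refine Finset.card_le_card fun k => ?_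
  simp only [Finset.mem_filter, Finset.mem_univ, true_and]
  exact fun h => h.trans_le hst

lemma ltCount_le {K : ℕ} (v : Fin K → unitInterval) (t : ℝ) : ltCount v t ≤ K :=
  (Finset.card_filter_le _ _).trans (by simp)

lemma monotone_orderStat {K : ℕ} (v : Fin K → unitInterval) : Monotone (orderStat v) :=
  Tuple.monotone_sort v

/-- Trades sorting for counting; since `i` is 0-based, the inequality on the right is strict. -/
lemma orderStat_lt_iff {K : ℕ} (v : Fin K → unitInterval) (i : Fin K) (t : ℝ) :
    (orderStat v i : ℝ) < t ↔ (i : ℕ) < ltCount v t := by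
  have hm : Monotone fun j => (orderStat v j : ℝ) := fun a b hab => monotone_orderStat v hab
  rw [← Tuple.lt_card_lt_iff_apply_lt_of_monotone hm]
  have : (Finset.univ.filter fun j => (orderStat v j : ℝ) < t).card = ltCount v t := by
    refine Finset.card_equiv (Tuple.sort v) fun j => ?_
    rw [Finset.mem_filter, Finset.mem_filter]
    simp [orderStat]
  rw [this]

lemma orderStat_const {K : ℕ} (u : unitInterval) (i : Fin K) :
    orderStat (fun _ => u) i = u := rfl

lemma measurable_ltCount {K : ℕ} (t : ℝ) :
    Measurable fun v : Fin K → unitInterval => ltCount v t := by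
  simp only [ltCount, Finset.card_filter]
  refine Finset.measurable_sum _ fun k _ => ?_
  refine Measurable.ite ?_ measurable_const measurable_const
  exact measurableSet_lt (by fun_prop) measurable_const

lemma measurable_orderStat {K : ℕ} (i : Fin K) :
    Measurable fun v : Fin K → unitInterval => (orderStat v i : ℝ) := by
  refine measurable_of_Iio fun t => ?_
  have : (fun v : Fin K → unitInterval => (orderStat v i : ℝ)) ⁻¹' Set.Iio t
      = (fun v : Fin K → unitInterval => ltCount v t) ⁻¹' Set.Ioi (i : ℕ) := by
    ext v; exact orderStat_lt_iff v i t
  rw [this]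
  exact measurable_ltCount t measurableSet_Ioi

lemma measurable_orderStatFun {K : ℕ} (α : Fin K → NNReal) : Measurable (orderStatFun α) := by
  unfold orderStatFun
  refine Measurable.iInf fun i => ?_
  split_ifs
  · exact measurable_const
  · exact (measurable_orderStat i).ennreal_ofReal.div_const _

/-- The convention for `α i = 0` is absorbed: the condition then reads `orderStat v i < 0`, which
fails, in accordance with the value `⊤`. -/
lemma orderStatFun_lt_iff {K : ℕ} (α : Fin K → NNReal) (v : Fin K → unitInterval) (x : NNReal) :
    orderStatFun α v < x ↔ ∃ i, (orderStat v i : ℝ) < x * α i := by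
  unfold orderStatFun
  rw [iInf_lt_iff]
  refine exists_congr fun i => ?_
  have h0 : (0 : ℝ) ≤ orderStat v i := (orderStat v i).2.1
  split_ifs with h
  · simp [h, h0]
  · rw [ENNReal.div_lt_iff (Or.inl (by simpa using h)) (Or.inl ENNReal.coe_ne_top),
      ← ENNReal.coe_mul, ← ENNReal.ofReal_coe_nnreal, ENNReal.ofReal_lt_ofReal_iff_of_nonneg h0]
    simp

/-! ### Measures of elementary sets -/

lemma volume_coe_lt {t : ℝ} (h0 : 0 ≤ t) (h1 : t ≤ 1) :
    volume {u : unitInterval | (u : ℝ) < t} = ENNReal.ofReal t :=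
  unitInterval.volume_Iio ⟨t, h0, h1⟩

lemma volume_le_coe {t : ℝ} (h0 : 0 ≤ t) (h1 : t ≤ 1) :
    volume {u : unitInterval | t ≤ (u : ℝ)} = ENNReal.ofReal (1 - t) :=
  unitInterval.volume_Ici ⟨t, h0, h1⟩

lemma volume_le_coe_lt {s t : ℝ} (hs : 0 ≤ s) (hst : s ≤ t) (h1 : t ≤ 1) :
    volume {u : unitInterval | s ≤ (u : ℝ) ∧ (u : ℝ) < t} = ENNReal.ofReal (t - s) :=
  unitInterval.volume_Ico ⟨s, hs, hst.trans h1⟩ ⟨t, hs.trans hst, h1⟩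

/-- Overwriting coordinate `k` leaves an event in the other coordinates alone, hence independent of
`v k`. -/
lemma volume_pi_eval_mem_and_update_mem {n : ℕ} (k : Fin (n + 1)) (a : unitInterval)
    {s : Set unitInterval} {T : Set (Fin (n + 1) → unitInterval)} (hs : MeasurableSet s)
    (hT : MeasurableSet T) :
    volume {v : Fin (n + 1) → unitInterval | v k ∈ s ∧ Function.update v k a ∈ T}
      = volume s * volume {v : Fin (n + 1) → unitInterval | Function.update v k a ∈ T} := by
  have hins : Measurable fun w : Fin n → unitInterval =>
      (k.insertNth a w : Fin (n + 1) → unitInterval) := by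
    have h1 := (MeasurableEquiv.piFinSuccAbove (fun _ : Fin (n + 1) => unitInterval) k).symm.measurable
    exact h1.comp (measurable_const.prodMk measurable_id)
  have hprod : ∀ s : Set unitInterval, MeasurableSet s →
      volume {v : Fin (n + 1) → unitInterval | v k ∈ s ∧ Function.update v k a ∈ T}
        = volume s * volume {w : Fin n → unitInterval |
            (k.insertNth a w : Fin (n + 1) → unitInterval) ∈ T} := by
    intro s hs
    have hmp := volume_preserving_piFinSuccAbove (fun _ : Fin (n + 1) => unitInterval) k
    rw [← Measure.prod_prod, ← Measure.volume_eq_prod,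
      ← hmp.measure_preimage (s := s ×ˢ {w : Fin n → unitInterval |
        (k.insertNth a w : Fin (n + 1) → unitInterval) ∈ T})
        (hs.prod (hins hT)).nullMeasurableSet]
    congr 1
    ext v
    simp only [Set.mem_preimage, Set.mem_prod]
    change _ ↔ v k ∈ s ∧ (k.insertNth a (k.removeNth v) : Fin (n + 1) → unitInterval) ∈ T
    rw [Fin.insertNth_removeNth]
    rfl
  have huniv := hprod Set.univ MeasurableSet.univ
  simp only [Set.mem_univ, true_and, measure_univ, one_mul] at huniv
  rw [hprod s hs, huniv]

lemma volume_forall_mem_coe_lt {K : ℕ} (S : Finset (Fin K)) {t : ℝ} (h0 : 0 ≤ t) (h1 : t ≤ 1) :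
    volume {v : Fin K → unitInterval | ∀ k ∈ S, (v k : ℝ) < t} = ENNReal.ofReal t ^ S.card := by
  have : {v : Fin K → unitInterval | ∀ k ∈ S, (v k : ℝ) < t}
      = Set.pi Set.univ fun k => if k ∈ S then {u : unitInterval | (u : ℝ) < t} else Set.univ := by
    ext v
    simp only [Set.mem_ofPred_eq, Set.mem_univ_pi]
    refine forall_congr' fun k => ?_
    split_ifs with h <;> simp [h]
  rw [this, volume_pi_pi]
  simp only [apply_ite (volume : Measure unitInterval), volume_coe_lt h0 h1, measure_univ]
  rw [Finset.prod_ite_mem, Finset.univ_inter, Finset.prod_const]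

/-- Union bound over the `m`-element sets of coordinates. -/
lemma volume_le_ltCount {K : ℕ} (m : ℕ) {t : ℝ} (h0 : 0 ≤ t) (h1 : t ≤ 1) :
    volume {v : Fin K → unitInterval | m ≤ ltCount v t}
      ≤ (K.choose m : ENNReal) * ENNReal.ofReal t ^ m := by
  have hsub : {v : Fin K → unitInterval | m ≤ ltCount v t} ⊆
      ⋃ S ∈ Finset.powersetCard m (Finset.univ : Finset (Fin K)),
        {v : Fin K → unitInterval | ∀ k ∈ S, (v k : ℝ) < t} := by
    intro v hv
    obtain ⟨S, hS, hcard⟩ := Finset.exists_subset_card_eq (show m ≤ ltCount v t from hv)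
    simp only [Set.mem_iUnion, Finset.mem_powersetCard]
    exact ⟨S, ⟨Finset.subset_univ _, hcard⟩, fun k hk => (Finset.mem_filter.1 (hS hk)).2⟩
  refine (measure_mono hsub).trans ((measure_biUnion_finset_le _ _).trans ?_)
  rw [Finset.sum_congr rfl fun S hS => by
    rw [volume_forall_mem_coe_lt S h0 h1, (Finset.mem_powersetCard.1 hS).2]]
  simp

/-! ### The Simes identity -/

/-- The largest `r ≤ K` such that at least `r` coordinates of `v` are below `x * r / K`. -/
noncomputable def simesIndex {K : ℕ} (x : ℝ) (v : Fin K → unitInterval) : ℕ :=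
  Nat.findGreatest (fun r => r ≤ ltCount v (x * r / K)) K

lemma simesIndex_le_ltCount {K : ℕ} (x : ℝ) (v : Fin K → unitInterval) :
    simesIndex x v ≤ ltCount v (x * simesIndex x v / K) :=
  Nat.findGreatest_spec (P := fun r : ℕ => r ≤ ltCount v (x * r / K)) (Nat.zero_le K)
    (Nat.zero_le _)

lemma le_simesIndex {K : ℕ} {x : ℝ} {v : Fin K → unitInterval} {r : ℕ}
    (h : r ≤ ltCount v (x * r / K)) : r ≤ simesIndex x v :=
  Nat.le_findGreatest (P := fun r : ℕ => r ≤ ltCount v (x * r / K))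
    (h.trans (ltCount_le _ _)) h

/-- By maximality: a strictly larger count s would still satisfy s ≤ `ltCount v (x * s / K)`, the
threshold having grown. -/
lemma ltCount_simesIndex {K : ℕ} {x : ℝ} (hx : 0 ≤ x) (v : Fin K → unitInterval) :
    ltCount v (x * simesIndex x v / K) = simesIndex x v := by
  have h := simesIndex_le_ltCount x v
  refine le_antisymm (le_simesIndex (ltCount_mono v ?_)) h
  gcongr

lemma measurable_simesIndex {K : ℕ} (x : ℝ) :
    Measurable fun v : Fin K → unitInterval => simesIndex x v := by
  refine measurable_findGreatest fun r _ => ?_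
  exact measurable_ltCount _ measurableSet_Ici

/-- Whether the index equals `r` depends only on the counts at thresholds x n / K with n ≥ r.
Coordinate `k` is already below all of these, so lowering it to 0 changes none of them. -/
lemma simesIndex_update_eq_iff {K : ℕ} {x : ℝ} (hx : 0 < x) {v : Fin K → unitInterval}
    {k : Fin K} {r : ℕ} (hr : 1 ≤ r) (hk : (v k : ℝ) < x * r / K) :
    simesIndex x (Function.update v k 0) = r ↔ simesIndex x v = r := by
  have hK : 0 < K := k.pos
  have hcount : ∀ n : ℕ, r ≤ n →
      ltCount (Function.update v k 0) (x * n / K) = ltCount v (x * n / K) := by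
    intro n hn
    unfold ltCount
    congr 1
    refine Finset.filter_congr fun j _ => ?_
    rcases eq_or_ne j k with rfl | hj
    · have hn0 : (0 : ℝ) < n := by exact_mod_cast (by omega : 0 < n)
      have h1 : (0 : ℝ) < x * n / K := by positivity
      have h2 : (v j : ℝ) < x * n / K := hk.trans_le (by gcongr)
      simp [h1, h2]
    · simp [hj]
  unfold simesIndex
  rw [Nat.findGreatest_eq_iff, Nat.findGreatest_eq_iff, hcount r le_rfl]
  refine and_congr_right fun _ => and_congr_right fun _ => ?_
  refine forall_congr' fun n => forall_congr' fun hn => ?_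
  rw [hcount n hn.le]

lemma one_le_simesIndex_update {K : ℕ} {x : ℝ} (hx : 0 < x) (v : Fin K → unitInterval)
    (k : Fin K) : 1 ≤ simesIndex x (Function.update v k 0) := by
  have hK : 0 < K := k.pos
  refine le_simesIndex (Finset.card_pos.2 ⟨k, ?_⟩)
  simp only [Finset.mem_filter, Finset.mem_univ, true_and, Function.update_self]
  have : (0 : ℝ) < K := by exact_mod_cast hK
  have : (0 : ℝ) < x * ((1 : ℕ) : ℝ) / K := by positivity
  simpa using this

/-- When the index is r ≥ 1, exactly r coordinates lie below x r / K, so the weights 1/r add up to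
1. -/
lemma sum_indicator_simesIndex {K : ℕ} {x : ℝ} (hx : 0 ≤ x) (v : Fin K → unitInterval) :
    ∑ k : Fin K, ∑ r ∈ Finset.Icc 1 K, (r : ENNReal)⁻¹ *
        ({w : Fin K → unitInterval | (w k : ℝ) < x * r / K ∧ simesIndex x w = r}.indicator 1 v)
      = {w : Fin K → unitInterval | 1 ≤ simesIndex x w}.indicator 1 v := by
  classical
  have hle : simesIndex x v ≤ K := Nat.findGreatest_le K
  simp only [Set.indicator_apply, Set.mem_ofPred_eq, Pi.one_apply]
  rw [Finset.sum_comm]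
  have hinner : ∀ r : ℕ, (∑ k : Fin K, (r : ENNReal)⁻¹ *
      (if (v k : ℝ) < x * r / K ∧ simesIndex x v = r then 1 else 0)) =
      if simesIndex x v = r then (r : ENNReal)⁻¹ * (ltCount v (x * r / K) : ENNReal) else 0 := by
    intro r
    split_ifs with h
    · simp only [h, and_true]
      rw [← Finset.mul_sum, Finset.sum_boole]
      rfl
    · simp [h]
  simp only [hinner]
  rw [Finset.sum_ite_eq]
  by_cases h : 1 ≤ simesIndex x v
  · rw [if_pos (Finset.mem_Icc.2 ⟨h, hle⟩), if_pos h, ltCount_simesIndex hx]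
    exact ENNReal.inv_mul_cancel (by simpa using (by omega : simesIndex x v ≠ 0))
      (ENNReal.natCast_ne_top _)
  · rw [if_neg fun h' => h (Finset.mem_Icc.1 h').1, if_neg h]

lemma volume_one_le_simesIndex {n : ℕ} {x : ℝ} (hx : 0 < x) (hx1 : x ≤ 1) :
    volume {v : Fin (n + 1) → unitInterval | 1 ≤ simesIndex x v} = ENNReal.ofReal x := by
  have hK : (0 : ℝ) < ((n + 1 : ℕ) : ℝ) := by positivity
  have hms : ∀ (k : Fin (n + 1)) (r : ℕ), MeasurableSet {w : Fin (n + 1) → unitInterval |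
      (w k : ℝ) < x * r / (n + 1 : ℕ) ∧ simesIndex x w = r} := by
    intro k r
    refine MeasurableSet.inter ?_ (measurable_simesIndex x (measurableSet_singleton r))
    exact measurableSet_lt (f := fun w : Fin (n + 1) → unitInterval => (w k : ℝ)) (by fun_prop)
      measurable_const
  -- Once `k` is zeroed, the index is independent of `w k`, and the factor r⁻¹ cancels the r in P(w
  -- k < x r / K) = x r / K.
  have hterm : ∀ (k : Fin (n + 1)), ∀ r ∈ Finset.Icc 1 (n + 1),
      (r : ENNReal)⁻¹ * volume {w : Fin (n + 1) → unitInterval |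
        (w k : ℝ) < x * r / (n + 1 : ℕ) ∧ simesIndex x w = r}
      = ENNReal.ofReal (x / (n + 1 : ℕ)) *
        volume ((fun w : Fin (n + 1) → unitInterval => simesIndex x (Function.update w k 0)) ⁻¹'
          {r}) := by
    intro k r hr
    obtain ⟨hr1, hrn⟩ := Finset.mem_Icc.1 hr
    have hset : {w : Fin (n + 1) → unitInterval |
        (w k : ℝ) < x * r / (n + 1 : ℕ) ∧ simesIndex x w = r}
        = {w : Fin (n + 1) → unitInterval |
          w k ∈ {u : unitInterval | (u : ℝ) < x * r / (n + 1 : ℕ)} ∧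
            Function.update w k 0 ∈ simesIndex x ⁻¹' {r}} := by
      ext w
      exact and_congr_right fun h => (simesIndex_update_eq_iff hx hr1 h).symm
    have hr0 : (0 : ℝ) < r := by exact_mod_cast hr1
    have hle : x * r / (n + 1 : ℕ) ≤ 1 := by
      rw [div_le_one hK]
      have : (r : ℝ) ≤ (n + 1 : ℕ) := by exact_mod_cast hrn
      nlinarith
    rw [hset, volume_pi_eval_mem_and_update_mem k 0
      (measurableSet_lt measurable_subtype_coe measurable_const)
      (measurable_simesIndex x (measurableSet_singleton r)),
      volume_coe_lt (by positivity) hle, ← mul_assoc]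
    congr 1
    have : x * r / (n + 1 : ℕ) = r * (x / (n + 1 : ℕ)) := by ring
    rw [this, ENNReal.ofReal_mul hr0.le, ENNReal.ofReal_natCast, ← mul_assoc,
      ENNReal.inv_mul_cancel (by simpa using (by omega : r ≠ 0)) (ENNReal.natCast_ne_top _),
      one_mul]
  have hA : MeasurableSet {v : Fin (n + 1) → unitInterval | 1 ≤ simesIndex x v} :=
    measurable_simesIndex x measurableSet_Ici
  rw [← lintegral_indicator_one hA]
  simp only [← sum_indicator_simesIndex hx.le]
  rw [lintegral_finsetSum _ fun k _ => Finset.measurable_sum _ fun r _ =>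
    (measurable_one.indicator (hms k r)).const_mul _]
  have hk : ∀ k : Fin (n + 1), ∫⁻ v, ∑ r ∈ Finset.Icc 1 (n + 1), (r : ENNReal)⁻¹ *
        ({w : Fin (n + 1) → unitInterval | (w k : ℝ) < x * r / (n + 1 : ℕ) ∧
          simesIndex x w = r}.indicator 1 v) = ENNReal.ofReal (x / (n + 1 : ℕ)) := by
    intro k
    rw [lintegral_finsetSum _ fun r _ => (measurable_one.indicator (hms k r)).const_mul _]
    rw [Finset.sum_congr rfl fun r _ => by
      rw [lintegral_const_mul (r : ENNReal)⁻¹ (measurable_one.indicator (hms k r)),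
        lintegral_indicator_one (hms k r)]]
    rw [Finset.sum_congr rfl (hterm k), ← Finset.mul_sum, sum_measure_preimage_singleton]
    -- A zeroed coordinate is below x / K, so the index lies in 1, …, n + 1 and the probabilities
    -- sum to 1.
    · have : (fun w : Fin (n + 1) → unitInterval => simesIndex x (Function.update w k 0)) ⁻¹'
          (Finset.Icc 1 (n + 1) : Finset ℕ) = Set.univ := by
        refine Set.eq_univ_of_forall fun w => ?_
        simp only [Set.mem_preimage, Finset.mem_coe, Finset.mem_Icc]
        exact ⟨one_le_simesIndex_update hx w k, Nat.findGreatest_le _⟩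
      rw [this, measure_univ, mul_one]
    · intro r _
      exact ((measurable_simesIndex x).comp
        (measurable_update_left)) (measurableSet_singleton r)
  simp only [hk]
  rw [Finset.sum_const, Finset.card_univ, Fintype.card_fin, nsmul_eq_mul,
    ← ENNReal.ofReal_natCast, ← ENNReal.ofReal_mul (by positivity), mul_div_cancel₀ _ hK.ne']

/-- The Simes identity. -/
lemma volume_exists_orderStat_lt_simes {n : ℕ} {x : ℝ} (hx : 0 < x) (hx1 : x ≤ 1) :
    volume {v : Fin (n + 1) → unitInterval |
      ∃ i, (orderStat v i : ℝ) < x * (((i : ℕ) + 1) / (n + 1 : ℕ))} = ENNReal.ofReal x := by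
  rw [← volume_one_le_simesIndex (n := n) hx hx1]
  congr 1
  ext v
  simp only [Set.mem_ofPred_eq, orderStat_lt_iff]
  -- The 0-based position i corresponds to r = i + 1.
  constructor
  · rintro ⟨i, hi⟩
    refine le_trans (Nat.le_add_left 1 i) (le_simesIndex ?_)
    rw [Nat.succ_le_iff]
    convert hi using 2
    push_cast; ring
  · intro h
    have hle : simesIndex x v ≤ n + 1 := Nat.findGreatest_le _
    refine ⟨⟨simesIndex x v - 1, by omega⟩, ?_⟩
    have h1 := simesIndex_le_ltCount x v
    have h2 : ((simesIndex x v - 1 : ℕ) : ℝ) + 1 = simesIndex x v := by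
      rw [Nat.cast_sub h]; simp
    change simesIndex x v - 1 < ltCount v
      (x * ((((simesIndex x v - 1 : ℕ) : ℝ) + 1) / (n + 1 : ℕ)))
    rw [h2, ← mul_div_assoc]
    omega

/-! ### Uniqueness of the balanced weights -/

lemma measurableSet_exists_orderStat_lt {K : ℕ} (β : Fin K → ℝ) :
    MeasurableSet {v : Fin K → unitInterval | ∃ i, (orderStat v i : ℝ) < β i} := by
  rw [Set.ofPred_exists]
  exact MeasurableSet.iUnion fun i => measurableSet_lt (measurable_orderStat i) measurable_const

lemma volume_box {K : ℕ} (j : Fin K) {s t x : ℝ} (hs : 0 ≤ s) (hst : s ≤ t) (ht : t ≤ 1)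
    (hx0 : 0 ≤ x) (hx1 : x ≤ 1) :
    volume {v : Fin K → unitInterval | ∀ k, if k ≤ j then s ≤ (v k : ℝ) ∧ (v k : ℝ) < t
      else x ≤ (v k : ℝ)} =
      ENNReal.ofReal ((t - s) ^ ((j : ℕ) + 1) * (1 - x) ^ (K - ((j : ℕ) + 1))) := by
  have : {v : Fin K → unitInterval | ∀ k, if k ≤ j then s ≤ (v k : ℝ) ∧ (v k : ℝ) < t
      else x ≤ (v k : ℝ)} = Set.pi Set.univ fun k => if k ≤ j then
        {u : unitInterval | s ≤ (u : ℝ) ∧ (u : ℝ) < t} else {u : unitInterval | x ≤ (u : ℝ)} := by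
    ext v
    simp only [Set.mem_ofPred_eq, Set.mem_univ_pi]
    refine forall_congr' fun k => ?_
    split_ifs <;> rfl
  rw [this, volume_pi_pi]
  simp only [apply_ite (volume : Measure unitInterval), volume_le_coe_lt hs hst ht,
    volume_le_coe hx0 hx1]
  rw [Finset.prod_ite, Finset.prod_const, Finset.prod_const]
  have h1 : (Finset.univ.filter fun k : Fin K => k ≤ j).card = (j : ℕ) + 1 := by
    rw [← Fin.card_Iic]
    congr 1
    ext k
    simp
  have h2 : (Finset.univ.filter fun k : Fin K => ¬ k ≤ j).card = K - ((j : ℕ) + 1) := by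
    have := Finset.card_filter_add_card_filter_not (s := (Finset.univ : Finset (Fin K))) (· ≤ j)
    rw [h1, Finset.card_univ, Fintype.card_fin] at this
    omega
  rw [h1, h2, ← ENNReal.ofReal_pow (by linarith), ← ENNReal.ofReal_pow (by linarith),
    ← ENNReal.ofReal_mul (by have : 0 ≤ t - s := by linarith
                             positivity)]

/-- Two monotone weights whose violation probabilities agree cannot first differ at `j` with
`β j < β' j`. -/
lemma not_lt_of_volume_eq {K : ℕ} {β β' : Fin K → ℝ} (hβ : Monotone β)
    (hβ0 : ∀ i, 0 ≤ β i) (hβ1 : ∀ i, β i ≤ 1) (hβ1' : ∀ i, β' i ≤ 1)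
    (hvol : ∀ x : ℝ, 0 < x → x ≤ 1 →
      volume {v : Fin K → unitInterval | ∃ i, (orderStat v i : ℝ) < x * β i}
        = volume {v : Fin K → unitInterval | ∃ i, (orderStat v i : ℝ) < x * β' i})
    (j : Fin K) (hj : ∀ i < j, β i = β' i) : ¬ β j < β' j := by
  intro hlt
  -- Equal volumes of A and B force equal volumes of B \ A and A \ B. Bounding the first below and
  -- the second above, then dividing by x^(j+1), gives the inequality.
  have hineq : ∀ x : ℝ, 0 < x → x ≤ 1 →
      (β' j - β j) ^ ((j : ℕ) + 1) * (1 - x) ^ (K - ((j : ℕ) + 1))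
        ≤ (K.choose ((j : ℕ) + 2) : ℝ) * x := by
    intro x hx hx1
    have hmA := measurableSet_exists_orderStat_lt fun i => x * β i
    have hmB := measurableSet_exists_orderStat_lt fun i => x * β' i
    set A := {v : Fin K → unitInterval | ∃ i, (orderStat v i : ℝ) < x * β i} with hA
    set B := {v : Fin K → unitInterval | ∃ i, (orderStat v i : ℝ) < x * β' i} with hB
    have hle : ∀ i, x * β i ≤ x := fun i => mul_le_of_le_one_right hx.le (hβ1 i)
    have hdiff : volume (B \ A) = volume (A \ B) := by
      have h1 := measure_sdiff_add_inter (μ := volume) B hmA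
      have h2 := measure_sdiff_add_inter (μ := volume) A hmB
      rw [Set.inter_comm, ← hvol x hx hx1, ← h2] at h1
      exact (ENNReal.add_left_inj (measure_ne_top _ _)).1 h1
    -- In this box exactly j + 1 coordinates lie below x β' j, which violates at j for β'. For β, no
    -- coordinate is below the thresholds up to j, and at most j + 1 are below any later one.
    have hbox : {v : Fin K → unitInterval | ∀ k, if k ≤ j then
        x * β j ≤ (v k : ℝ) ∧ (v k : ℝ) < x * β' j else x ≤ (v k : ℝ)} ⊆ B \ A := by
      intro v hv
      have hv' : ∀ k, if k ≤ j then x * β j ≤ (v k : ℝ) ∧ (v k : ℝ) < x * β' j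
        else x ≤ (v k : ℝ) := hv
      refine ⟨⟨j, ?_⟩, ?_⟩
      · rw [orderStat_lt_iff]
        have hsub : Finset.Iic j ⊆ Finset.univ.filter fun k => (v k : ℝ) < x * β' j := by
          intro k hk
          have := hv' k
          rw [if_pos (Finset.mem_Iic.1 hk)] at this
          exact Finset.mem_filter.2 ⟨Finset.mem_univ _, this.2⟩
        have := Finset.card_le_card hsub
        rw [Fin.card_Iic] at this
        exact this
      · rintro ⟨i, hi⟩
        rw [orderStat_lt_iff] at hi
        rcases le_or_gt i j with hij | hij
        · have : ltCount v (x * β i) = 0 := by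
            refine Finset.card_eq_zero.2 (Finset.filter_eq_empty_iff.2 fun k _ => ?_)
            rw [not_lt]
            have h1 : x * β i ≤ x * β j := mul_le_mul_of_nonneg_left (hβ hij) hx.le
            have h2 := hv' k
            split_ifs at h2
            · exact h1.trans h2.1
            · exact (hle i).trans h2
          omega
        · have : ltCount v (x * β i) ≤ (j : ℕ) + 1 := by
            rw [← Fin.card_Iic]
            refine Finset.card_le_card fun k hk => Finset.mem_Iic.2 ?_
            by_contra hkj
            have h2 := hv' k
            rw [if_neg hkj] at h2
            exact absurd (Finset.mem_filter.1 hk).2 (not_lt.2 ((hle i).trans h2))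
          have : (j : ℕ) < i := hij
          omega
    -- Up to j the weights satisfy β ≤ β', so a violation for β alone occurs at some i > j and needs
    -- at least j + 2 coordinates below x.
    have hsub : A \ B ⊆ {v : Fin K → unitInterval | (j : ℕ) + 2 ≤ ltCount v x} := by
      rintro v ⟨⟨i, hi⟩, hvB⟩
      have hij : j < i := by
        by_contra hij
        refine hvB ⟨i, hi.trans_le (mul_le_mul_of_nonneg_left ?_ hx.le)⟩
        rcases (not_lt.1 hij).lt_or_eq with h | rfl
        · exact (hj i h).le
        · exact hlt.le
      have h1 := (orderStat_lt_iff v i _).1 hi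
      have h2 := ltCount_mono v (hle i)
      have h3 : (j : ℕ) < i := hij
      change (j : ℕ) + 2 ≤ ltCount v x
      omega
    have h1 := (measure_mono hbox).trans (hdiff.le.trans ((measure_mono hsub).trans
      (volume_le_ltCount _ hx.le hx1)))
    rw [volume_box j (mul_nonneg hx.le (hβ0 j)) (by gcongr)
      (by nlinarith [hβ1' j]) hx.le hx1, ← ENNReal.ofReal_pow hx.le, ← ENNReal.ofReal_natCast,
      ← ENNReal.ofReal_mul (by positivity), ENNReal.ofReal_le_ofReal_iff (by positivity)] at h1
    have hxp : 0 < x ^ ((j : ℕ) + 1) := by positivity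
    refine le_of_mul_le_mul_left ?_ hxp
    calc _ = (x * β' j - x * β j) ^ ((j : ℕ) + 1) * (1 - x) ^ (K - ((j : ℕ) + 1)) := by
          rw [← mul_sub, mul_pow, mul_assoc]
      _ ≤ _ := h1
      _ = _ := by ring
  -- Letting x → 0+ leaves a positive quantity bounded by 0.
  have hlim : (β' j - β j) ^ ((j : ℕ) + 1) * (1 - 0) ^ (K - ((j : ℕ) + 1))
      ≤ (K.choose ((j : ℕ) + 2) : ℝ) * 0 := by
    have hL : Filter.Tendsto (fun x : ℝ => (β' j - β j) ^ ((j : ℕ) + 1) *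
        (1 - x) ^ (K - ((j : ℕ) + 1))) (nhdsWithin 0 (Set.Ioi 0))
        (nhds ((β' j - β j) ^ ((j : ℕ) + 1) * (1 - 0) ^ (K - ((j : ℕ) + 1)))) :=
      (Continuous.tendsto (by fun_prop) 0).mono_left nhdsWithin_le_nhds
    have hR : Filter.Tendsto (fun x : ℝ => (K.choose ((j : ℕ) + 2) : ℝ) * x)
        (nhdsWithin 0 (Set.Ioi 0)) (nhds ((K.choose ((j : ℕ) + 2) : ℝ) * 0)) :=
      (Continuous.tendsto (by fun_prop) 0).mono_left nhdsWithin_le_nhds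
    refine le_of_tendsto_of_tendsto hL hR ?_
    filter_upwards [Ioc_mem_nhdsGT zero_lt_one] with x hx using hineq x hx.1 hx.2
  have : 0 < (β' j - β j) ^ ((j : ℕ) + 1) := pow_pos (by linarith) _
  rw [sub_zero, one_pow, mul_one, mul_zero] at hlim
  linarith

lemma eq_of_volume_eq {K : ℕ} {β β' : Fin K → ℝ} (hβ : Monotone β) (hβ' : Monotone β')
    (hβ0 : ∀ i, 0 ≤ β i) (hβ0' : ∀ i, 0 ≤ β' i) (hβ1 : ∀ i, β i ≤ 1) (hβ1' : ∀ i, β' i ≤ 1)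
    (hvol : ∀ x : ℝ, 0 < x → x ≤ 1 →
      volume {v : Fin K → unitInterval | ∃ i, (orderStat v i : ℝ) < x * β i}
        = volume {v : Fin K → unitInterval | ∃ i, (orderStat v i : ℝ) < x * β' i}) :
    β = β' := by
  funext i
  induction i using WellFoundedLT.induction with
  | ind j ih =>
    exact le_antisymm
      (not_lt.1 (not_lt_of_volume_eq hβ' hβ0' hβ1' hβ1 (fun x h0 h1 => (hvol x h0 h1).symm) j
        fun i hi => (ih i hi).symm))
      (not_lt.1 (not_lt_of_volume_eq hβ hβ0 hβ1 hβ1' hvol j ih))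

/-! ### Order-statistics functions -/

lemma ENNReal.eq_of_forall_nnreal_lt_iff {a b : ENNReal} (h : ∀ r : NNReal, a < r ↔ b < r) :
    a = b := by
  refine eq_of_forall_gt_iff fun c => ?_
  rw [ENNReal.lt_iff_exists_nnreal_btwn, ENNReal.lt_iff_exists_nnreal_btwn]
  simp only [h]

/-- If the maximum up to i is attained at j ≤ i, then p_(j) ≤ p_(i), so a violation at i for the
maximum is already one at j for α. This supplies the monotonicity that uniqueness of the weights
requires. -/
lemma orderStatFun_runningMax {K : ℕ} (α : Fin K → NNReal) :
    orderStatFun (fun i => (Finset.Iic i).sup α) = orderStatFun α := by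
  funext v
  refine ENNReal.eq_of_forall_nnreal_lt_iff fun x => ?_
  rw [orderStatFun_lt_iff, orderStatFun_lt_iff]
  constructor
  · rintro ⟨i, hi⟩
    obtain ⟨j, hj, hji⟩ := Finset.exists_mem_eq_sup (Finset.Iic i) ⟨i, by simp⟩ α
    rw [hji] at hi
    exact ⟨j, lt_of_le_of_lt (monotone_orderStat v (Finset.mem_Iic.1 hj)) hi⟩
  · rintro ⟨i, hi⟩
    refine ⟨i, hi.trans_le ?_⟩
    have : α i ≤ (Finset.Iic i).sup α := Finset.le_sup (Finset.mem_Iic.2 le_rfl)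
    gcongr

lemma orderStatFun_const_mul {K : ℕ} {m : NNReal} (hm : 0 < m) (β : Fin K → NNReal)
    (v : Fin K → unitInterval) :
    orderStatFun (fun i => m * β i) v = ((m⁻¹ : NNReal) : ENNReal) * orderStatFun β v := by
  refine ENNReal.eq_of_forall_nnreal_lt_iff fun x => ?_
  have hm' : (m : ENNReal) ≠ 0 := by simpa using hm.ne'
  rw [orderStatFun_lt_iff, ENNReal.coe_inv hm.ne', mul_comm, ← div_eq_mul_inv,
    ENNReal.div_lt_iff (Or.inl hm') (Or.inl ENNReal.coe_ne_top), ← ENNReal.coe_mul,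
    orderStatFun_lt_iff]
  simp only [NNReal.coe_mul, mul_assoc]

lemma simes_lt_iff {n : ℕ} (v : Fin (n + 1) → unitInterval) (x : NNReal) :
    simes (n + 1) v < x ↔
      ∃ i, (orderStat v i : ℝ) < x * (((i : ℕ) + 1) / (n + 1 : ℕ)) := by
  unfold simes
  rw [orderStatFun_lt_iff]
  simp

lemma exists_lt_mul_iff_of_monotone {n : ℕ} {β : Fin (n + 1) → ℝ} (hβ : Monotone β)
    (hlast : β (Fin.last n) = 1) {x : ℝ} (hx : 0 ≤ x) (u : unitInterval) :
    (∃ i, (orderStat (fun _ : Fin (n + 1) => u) i : ℝ) < x * β i) ↔ (u : ℝ) < x := by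
  simp only [orderStat_const]
  constructor
  · rintro ⟨i, hi⟩
    refine hi.trans_le (mul_le_of_le_one_right hx ?_)
    rw [← hlast]
    exact hβ (Fin.le_last i)
  · intro h
    exact ⟨Fin.last n, by rwa [hlast, mul_one]⟩

lemma monotone_simes_weight (n : ℕ) :
    Monotone fun i : Fin (n + 1) => (((i : ℕ) : ℝ) + 1) / ((n + 1 : ℕ) : ℝ) := by
  intro i j hij
  have : ((i : ℕ) : ℝ) ≤ (j : ℕ) := by exact_mod_cast hij
  change (((i : ℕ) : ℝ) + 1) / ((n + 1 : ℕ) : ℝ) ≤ (((j : ℕ) : ℝ) + 1) / ((n + 1 : ℕ) : ℝ)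
  gcongr

lemma simes_weight_last (n : ℕ) :
    (((Fin.last n : ℕ) : ℝ) + 1) / ((n + 1 : ℕ) : ℝ) = 1 := by
  rw [Fin.val_last, ← Nat.cast_succ]
  exact div_self (by positivity)

lemma icBalanced_simes (n : ℕ) : ICBalanced (simes (n + 1)) := by
  have hm : Measurable (simes (n + 1)) := measurable_orderStatFun _
  have hd : Measurable fun u : unitInterval => simes (n + 1) fun _ => u :=
    hm.comp (measurable_pi_lambda _ fun _ => measurable_id)
  have hdiag : ∀ (u : unitInterval) (x : NNReal), simes (n + 1) (fun _ => u) < x ↔ (u : ℝ) < x :=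
    fun u x => (simes_lt_iff _ x).trans (exists_lt_mul_iff_of_monotone
      (β := fun i : Fin (n + 1) => (((i : ℕ) : ℝ) + 1) / ((n + 1 : ℕ) : ℝ))
      (monotone_simes_weight n) (simes_weight_last n) x.2 u)
  have hsmall : ∀ x : NNReal, x ≤ 1 → volume {v | simes (n + 1) v < x} = x := by
    intro x hx1
    rcases eq_or_ne x 0 with rfl | hx0
    · simp
    · simp only [simes_lt_iff]
      rw [volume_exists_orderStat_lt_simes (NNReal.coe_pos.2 (pos_iff_ne_zero.2 hx0))
        (by exact_mod_cast hx1), ENNReal.ofReal_coe_nnreal]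
  have hsmall' : ∀ x : NNReal, x ≤ 1 →
      volume {u : unitInterval | simes (n + 1) (fun _ => u) < x} = x := by
    intro x hx1
    simp only [hdiag]
    exact (volume_coe_lt x.2 (by exact_mod_cast hx1)).trans ENNReal.ofReal_coe_nnreal
  -- The level 1 already carries full mass, so larger levels, including ⊤, need no computation.
  have hlarge : ∀ y : ENNReal, 1 ≤ y → volume {v | simes (n + 1) v < y} = 1 := by
    intro y hy
    refine le_antisymm prob_le_one ?_
    have := hsmall 1 le_rfl
    simp only [ENNReal.coe_one] at this
    rw [← this]
    exact measure_mono fun v hv => lt_of_lt_of_le hv hy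
  have hlarge' : ∀ y : ENNReal, 1 ≤ y →
      volume {u : unitInterval | simes (n + 1) (fun _ => u) < y} = 1 := by
    intro y hy
    refine le_antisymm prob_le_one ?_
    have := hsmall' 1 le_rfl
    simp only [ENNReal.coe_one] at this
    rw [← this]
    exact measure_mono fun v hv => lt_of_lt_of_le hv hy
  have hlt : ∀ y : ENNReal, volume {v | simes (n + 1) v < y}
      = volume {u : unitInterval | simes (n + 1) (fun _ => u) < y} := by
    intro y
    rcases le_total 1 y with hy | hy
    · rw [hlarge y hy, hlarge' y hy]
    · lift y to NNReal using ne_top_of_le_ne_top ENNReal.one_ne_top hy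
      have hy' : y ≤ 1 := by exact_mod_cast hy
      rw [hsmall y hy', hsmall' y hy']
  refine ⟨hm.aemeasurable, hd.aemeasurable, ?_⟩
  have := Measure.isProbabilityMeasure_map
    (μ := (volume : Measure (Fin (n + 1) → unitInterval))) hm.aemeasurable
  have := Measure.isProbabilityMeasure_map (μ := (volume : Measure unitInterval)) hd.aemeasurable
  refine Measure.ext_of_Ici _ _ fun y => ?_
  rw [← Set.compl_Iio, prob_compl_eq_one_sub measurableSet_Iio,
    prob_compl_eq_one_sub measurableSet_Iio, Measure.map_apply hm measurableSet_Iio,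
    Measure.map_apply hd measurableSet_Iio]
  exact congrArg (fun z => 1 - z) (hlt y)

/-- Dividing by the largest weight `m` makes the diagonal event u < x, of probability x. Balance
transfers this value to independent coordinates, where the Simes weights give the same one, so the
normalized weights coincide with them. -/
lemma exists_eq_simes_of_icBalanced {n : ℕ} {γ : Fin (n + 1) → NNReal} (hγ : Monotone γ)
    (hlast : 0 < γ (Fin.last n)) (hb : ICBalanced (orderStatFun γ)) :
    ∃ c : NNReal, 0 < c ∧ ∀ p, orderStatFun γ p = (c : ENNReal) * simes (n + 1) p := by
  set m := γ (Fin.last n) with hm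
  have hm0 : (0 : ℝ) < m := by exact_mod_cast hlast
  have hβmono : Monotone fun i => ((γ i : ℝ) / m) := by
    intro i j hij
    have : (γ i : ℝ) ≤ γ j := by exact_mod_cast hγ hij
    change (γ i : ℝ) / m ≤ (γ j : ℝ) / m
    gcongr
  have hβlast : (γ (Fin.last n) : ℝ) / m = 1 := div_self hm0.ne'
  have key : (fun i => ((γ i : ℝ) / m))
      = fun i : Fin (n + 1) => (((i : ℕ) : ℝ) + 1) / ((n + 1 : ℕ) : ℝ) := by
    refine eq_of_volume_eq hβmono (monotone_simes_weight n) (fun i => by positivity)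
      (fun i => by positivity) (fun i => hβlast ▸ hβmono (Fin.le_last i))
      (fun i => (monotone_simes_weight n (Fin.le_last i)).trans_eq (simes_weight_last n)) ?_
    intro x hx hx1
    rw [volume_exists_orderStat_lt_simes hx hx1]
    lift x to NNReal using hx.le
    have hiff : ∀ v, orderStatFun γ v < ((x / m : NNReal) : ENNReal) ↔
        ∃ i, (orderStat v i : ℝ) < x * ((γ i : ℝ) / m) := by
      intro v
      rw [orderStatFun_lt_iff]
      refine exists_congr fun i => ?_
      rw [NNReal.coe_div, div_mul_eq_mul_div, mul_div_assoc]
    have h1 := hb.measure_mem_eq (s := Set.Iio ((x / m : NNReal) : ENNReal)) measurableSet_Iio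
    simp only [Set.preimage, Set.mem_Iio, hiff] at h1
    rw [h1]
    simp only [exists_lt_mul_iff_of_monotone hβmono hβlast hx.le]
    exact volume_coe_lt hx.le hx1
  have hγeq : γ = fun i : Fin (n + 1) => m * (((i : NNReal) + 1) / ((n + 1 : ℕ) : NNReal)) := by
    funext i
    have := congrFun key i
    rw [div_eq_iff hm0.ne'] at this
    refine NNReal.coe_injective ?_
    rw [this]
    push_cast
    ring
  refine ⟨m⁻¹, inv_pos.2 hlast, fun p => ?_⟩
  rw [hγeq, orderStatFun_const_mul hlast]
  rfl

theorem orderStatFun_icBalanced_iff {K : ℕ} {α : Fin K → NNReal} (hα : ∃ i, α i ≠ 0) :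
    ICBalanced (orderStatFun α) ↔ ∃ c : NNReal, 0 < c ∧ ∀ p : Fin K → unitInterval,
      orderStatFun α p = (c : ENNReal) * simes K p := by
  obtain ⟨i, hi⟩ := hα
  obtain ⟨n, rfl⟩ : ∃ n, K = n + 1 := ⟨K - 1, by have := i.pos; omega⟩
  constructor
  · intro hb
    rw [← orderStatFun_runningMax α] at hb ⊢
    refine exists_eq_simes_of_icBalanced ?_ ?_ hb
    · exact fun i j hij => Finset.sup_mono (Finset.Iic_subset_Iic.2 hij)
    · exact (pos_iff_ne_zero.2 hi).trans_le
        (Finset.le_sup (f := α) (Finset.mem_Iic.2 (Fin.le_last i)))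
  · rintro ⟨c, -, hc⟩
    have : orderStatFun α = (fun y : ENNReal => (c : ENNReal) * y) ∘ simes (n + 1) := funext hc
    rw [this]
    exact (icBalanced_simes n).comp (measurable_const_mul (c : ENNReal))

theorem mainTheorem1 :
    (∀ φ : unitInterval → EReal, Continuous φ → (StrictMono φ ∨ StrictAnti φ) →
      ((∀ K : ℕ, 1 ≤ K → ICBalanced (generalizedMean φ K)) ↔
        ∃ a b : ℝ, a ≠ 0 ∧ ∀ p : unitInterval, 0 < p → p < 1 →
          φ p = ((a * Real.tan (Real.pi * ((p : ℝ) - 1 / 2)) + b : ℝ) : EReal)) ∧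
      ((∀ K : ℕ, 1 ≤ K → ICBalanced (generalizedMean φ K)) ↔
        ∀ K : ℕ, 1 ≤ K → ∀ p : Fin K → unitInterval, (∀ i, 0 < p i ∧ p i < 1) →
          (generalizedMean φ K p : ℝ) = cauchyCombination K p)) ∧
    (∀ (K : ℕ) (α : Fin K → NNReal), (∃ i, α i ≠ 0) →
      (ICBalanced (orderStatFun α) ↔
        ∃ c : NNReal, 0 < c ∧ ∀ p : Fin K → unitInterval,
          orderStatFun α p = (c : ENNReal) * simes K p)) :=
  ⟨fun _ hc h => generalizedMean_icBalanced_iff hc h, fun _ _ hα => orderStatFun_icBalanced_iff hα⟩
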